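/- Call complex numbers $z_1,\dots,z_n$ multiplicatively independent if they are all non-zero and there is no non-zero vector $(k_1,\dots,k_n)\in\mathbb{Z}^n$ with $z_1^{k_1}\cdots z_n^{k_n}=1$. For an algebraic number $\alpha\in\mathbb{C}$, the conjugates of $\alpha$ are the complex roots of its minimal polynomial over $\mathbb{Q}$; its house $\overline{|\alpha|}$ is the maximum of the absolute values of its conjugates, and $\alpha$ is totally real if all its conjugates are real. Theorem. Let $n\ge 2$ and let $\alpha_1,\dots,\alpha_n$ be pairwise distinct totally real algebraic numbers. Then there is a positive constant $C=C(n,\alpha_1,\dots,\alpha_n)$ such that for every totally real algebraic integer $t$ with $\overline{|t|}\ge C$, the $n$ algebraic numbers $\alpha_1+t,\dots,\alpha_n+t$ are multiplicatively independent. -/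

import Mathlib

/-- The conjugates of an algebraic number `α ∈ ℂ`: the complex roots of its minimal polynomial over
`ℚ`. -/
def algConjugates (α : ℂ) : Set ℂ :=
  (minpoly ℚ α).rootSet ℂ

/-- The house of an algebraic number: the maximum of the moduli of its conjugates. For algebraic `α`
the set of conjugates is finite and non-empty, so the supremum is a maximum. -/
noncomputable def algHouse (α : ℂ) : ℝ :=
  sSup ((fun z : ℂ => ‖z‖) '' algConjugates α)

/-- A complex number is a totally real algebraic number if it is algebraic over `ℚ` and all of its
conjugates are real. -/
def IsTotallyRealNumber (α : ℂ) : Prop :=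
  IsAlgebraic ℚ α ∧ ∀ z ∈ algConjugates α, z.im = 0

/-- Complex numbers `z₁, …, zₙ` are multiplicatively independent if they are all non-zero and
`z₁ ^ k₁ ⋯ zₙ ^ kₙ = 1` with integers `k₁, …, kₙ` forces `k₁ = ⋯ = kₙ = 0`. -/
def MultiplicativelyIndependent {n : ℕ} (z : Fin n → ℂ) : Prop :=
  (∀ i, z i ≠ 0) ∧ ∀ k : Fin n → ℤ, ∏ i, z i ^ k i = 1 → k = 0

/-!
Write `u j = α j + t` and suppose `∏ j, u j ^ k j = 1` with `k ≠ 0`. Let `i` be an index for which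
`|k i|` is maximal. The proof rests on two bounds.

*Lower bounds at every place.* The differences `u j - u i = α j - α i` are fixed and non-zero. Hence
if `u i` is very small at some place, every other `u j` is bounded above and below there by constants
depending only on the `α j`. Since no exponent exceeds `k i` in absolute value, the relation then
bounds `u i` from below (`pow_card_le_of_prod_zpow_eq_one`, stated for any linearly ordered group with
zero so as to cover all places at once). At the non-archimedean places, which are treated through the
valuation subrings of the field, this says that `m ^ n / u i` is an algebraic integer for a fixed
integer `m`; at the archimedean ones, that the conjugates of `m ^ n / u i` are bounded.

*The degree.* Applying an embedding `σ` of `ℚ(α, t)` to the relation, one sees that `σ t` is a real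
solution `x` of `∏ j, (b j + x) ^ k j = 1`, where `b j = σ (α j)` are distinct real numbers. By Rolle's
theorem for the logarithm of the left-hand side, the number of such solutions is bounded in terms of
`n` alone (`card_le_of_prod_zpow_eq_one`), and there are finitely many possible tuples `b`. So the
degree of `ℚ(α, t)` is bounded (`card_embeddings_le`).

The norm of the non-zero algebraic integer `m ^ n / u i` has absolute value at least `1`, it is a
product of boundedly many conjugates, and each conjugate is bounded above; so each conjugate is also
bounded away from `0`. Thus the conjugates of `u i`, and with them those of `t`, are bounded.
-/

open Finset Polynomial

/-! ### Multiplicative relations in linearly ordered groups with zero -/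

theorem pow_le_zpow_of_le_of_le_inv {Γ : Type*} [LinearOrderedCommGroupWithZero Γ] {c x : Γ}
    (hc0 : c ≠ 0) (hc1 : c ≤ 1) (hcx : c ≤ x) (hxc : x ≤ c⁻¹) {m : ℤ} {N : ℕ}
    (hm : m.natAbs ≤ N) : c ^ N ≤ x ^ m := by
  have hx : x ≠ 0 := ((zero_lt_iff.2 hc0).trans_le hcx).ne'
  have hle : c ^ N ≤ c ^ m.natAbs := pow_le_pow_right_of_le_one' hc1 hm
  refine hle.trans ?_
  rcases Int.natAbs_eq m with h | h
  · rw [h, Int.natAbs_natCast, zpow_natCast]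
    gcongr
  · rw [h, Int.natAbs_neg, Int.natAbs_natCast, zpow_neg, zpow_natCast, ← inv_pow]
    have : c ≤ x⁻¹ := by
      rw [le_inv_comm₀ (zero_lt_iff.2 hc0) (zero_lt_iff.2 hx)]
      exact hxc
    gcongr

/-- If `∏ j, x j ^ k j = 1`, the exponent `k i` is maximal in absolute value, and smallness of `x i`
forces the other `x j` to lie in `[c, c⁻¹]`, then `x i` is bounded below by a power of `c`. Here `x j`
stands for the size of a number at one place. -/
theorem pow_card_le_of_prod_zpow_eq_one {ι Γ : Type*} [Fintype ι]
    [LinearOrderedCommGroupWithZero Γ] {c : Γ} (hc0 : c ≠ 0) (hc1 : c ≤ 1) {x : ι → Γ}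
    {k : ι → ℤ} (hk : ∏ j, x j ^ k j = 1) {i : ι} (hki : k i ≠ 0)
    (hmax : ∀ j, (k j).natAbs ≤ (k i).natAbs)
    (h : x i < c → ∀ j, j ≠ i → c ≤ x j ∧ x j ≤ c⁻¹) : c ^ Fintype.card ι ≤ x i := by
  classical
  have hcard : 0 < Fintype.card ι := Fintype.card_pos_iff.2 ⟨i⟩
  rcases le_or_gt c (x i) with hle | hlt
  · exact (pow_le_of_le_one zero_le hc1 hcard.ne').trans hle
  -- Replacing `k` by `-k`, the exponent of `x i` may be taken positive.
  obtain ⟨l, hl, hli, habs⟩ : ∃ l : ι → ℤ, ∏ j, x j ^ l j = 1 ∧ l i = (k i).natAbs ∧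
      ∀ j, (l j).natAbs = (k j).natAbs := by
    rcases Int.natAbs_eq (k i) with h | h
    · exact ⟨k, hk, h, fun _ => rfl⟩
    · refine ⟨fun j => -k j, ?_, by dsimp only; omega, fun j => Int.natAbs_neg _⟩
      simp [zpow_neg, Finset.prod_inv_distrib, hk]
  rw [← Finset.mul_prod_erase _ _ (Finset.mem_univ i), hli, zpow_natCast] at hl
  have hprod : x i ^ (k i).natAbs = ∏ j ∈ univ.erase i, x j ^ (-l j) := by
    simp only [zpow_neg, Finset.prod_inv_distrib]
    exact eq_inv_of_mul_eq_one_left hl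
  have hlow : (c ^ (Fintype.card ι - 1)) ^ (k i).natAbs ≤ x i ^ (k i).natAbs := by
    rw [hprod, ← pow_mul, mul_comm, pow_mul, ← Finset.card_univ,
      ← Finset.card_erase_of_mem (Finset.mem_univ i)]
    rw [← Finset.prod_const]
    refine Finset.prod_le_prod' fun j hj => ?_
    obtain ⟨h1, h2⟩ := h hlt j (Finset.ne_of_mem_erase hj)
    exact pow_le_zpow_of_le_of_le_inv hc0 hc1 h1 h2
      (by rw [Int.natAbs_neg, habs]; exact hmax j)
  have := le_of_pow_le_pow_left₀ (by omega) zero_le hlow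
  exact (pow_le_pow_right_of_le_one' hc1 (Nat.sub_le _ _)).trans this

/-! ### Lower bounds at the non-archimedean and archimedean places -/

/-- The integral closure of `ℤ` in a field contains the intersection of all valuation subrings; this
replaces a factorisation into primes of a ring of integers. -/
theorem isIntegral_int_of_forall_mem_valuationSubring {K : Type*} [Field K] {x : K}
    (h : ∀ V : ValuationSubring K, x ∈ V) : IsIntegral ℤ x := by
  have hx : x ∈ (integralClosure (Subring.closure (∅ : Set K)) K).toSubring := by
    rw [← iInf_valuationSubring_superset]
    simp only [Subring.mem_iInf]
    intro V
    simpa using h V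
  have h1 : IsIntegral (Subring.closure (∅ : Set K)) x := hx
  have : Algebra.IsIntegral ℤ (Subring.closure (∅ : Set K)) := by
    refine ⟨fun y => ?_⟩
    obtain ⟨z, hz⟩ := Subring.mem_bot.1 (Subring.closure_empty.le y.2)
    have hzy : algebraMap ℤ (Subring.closure (∅ : Set K)) z = y := by
      ext
      simpa using hz
    exact hzy ▸ isIntegral_algebraMap
  exact isIntegral_trans x h1

/-- The lower bound at all non-archimedean places. The number `m` is a common denominator of the
`a i` and of the inverses of their differences; the constant at a valuation `v` is `v m`. -/
theorem isIntegral_pow_card_div_of_prod_zpow_eq_one {ι K : Type*} [Fintype ι] [Field K]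
    {a : ι → K} {t : K} {m : K} (hm0 : m ≠ 0) (hm : IsIntegral ℤ m)
    (ha : ∀ i, IsIntegral ℤ (m * a i))
    (hd : ∀ i j, i ≠ j → a i ≠ a j ∧ IsIntegral ℤ (m * (a i - a j)⁻¹))
    (ht : IsIntegral ℤ t) (hu : ∀ j, a j + t ≠ 0) {k : ι → ℤ} (hk : ∏ j, (a j + t) ^ k j = 1)
    {i : ι} (hki : k i ≠ 0) (hmax : ∀ j, (k j).natAbs ≤ (k i).natAbs) :
    IsIntegral ℤ (m ^ Fintype.card ι * (a i + t)⁻¹) := by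
  refine isIntegral_int_of_forall_mem_valuationSubring fun V => ?_
  have hint : ∀ {y : K}, IsIntegral ℤ y → V.valuation y ≤ 1 := fun hy => by
    rw [ValuationSubring.valuation_le_one_iff]
    obtain ⟨y, rfl⟩ := (IsIntegrallyClosed.isIntegral_iff (R := V)).1 (hy.tower_top (A := V))
    exact y.2
  have hv0 : ∀ {y : K}, y ≠ 0 → V.valuation y ≠ 0 := fun hy => (Valuation.ne_zero_iff _).2 hy
  have key : V.valuation m ^ Fintype.card ι ≤ V.valuation (a i + t) := by
    refine pow_card_le_of_prod_zpow_eq_one (x := fun j => V.valuation (a j + t)) (k := k)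
      (hv0 hm0) (hint hm) ?_ hki hmax ?_
    · simpa using congrArg V.valuation hk
    · intro hlt j hj
      obtain ⟨hne, hji⟩ := hd j i hj
      have hdiff : V.valuation m ≤ V.valuation (a j - a i) := by
        have := hint hji
        rwa [map_mul, map_inv₀, mul_inv_le_iff₀ (zero_lt_iff.2 (hv0 (sub_ne_zero.2 hne))),
          one_mul] at this
      constructor
      · -- As `a i + t` is smaller than `a j - a i`, their sum `a j + t` has the size of the latter.
        have : a j + t = (a j - a i) + (a i + t) := by ring
        rw [this, Valuation.map_add_eq_of_lt_left _ (hlt.trans_le hdiff)]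
        exact hdiff
      · have := hint ((ha j).add (hm.mul ht))
        rwa [← mul_add, map_mul, ← le_inv_mul_iff₀ (zero_lt_iff.2 (hv0 hm0)), mul_one] at this
  rw [← ValuationSubring.valuation_le_one_iff, map_mul, map_inv₀, map_pow,
    mul_inv_le_iff₀ (zero_lt_iff.2 (hv0 (hu i))), one_mul]
  exact key

/-- The lower bound at an archimedean place. -/
theorem pow_card_le_norm_of_prod_zpow_eq_one {ι : Type*} [Fintype ι]
    {a : ι → ℂ} {t : ℂ} {c : ℝ} (hc0 : 0 < c) (hc1 : c ≤ 1)
    (hd : ∀ i j, i ≠ j → 2 * c ≤ ‖a i - a j‖ ∧ ‖a i - a j‖ + c ≤ c⁻¹)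
    {k : ι → ℤ} (hk : ∏ j, (a j + t) ^ k j = 1)
    {i : ι} (hki : k i ≠ 0) (hmax : ∀ j, (k j).natAbs ≤ (k i).natAbs) :
    c ^ Fintype.card ι ≤ ‖a i + t‖ := by
  lift c to NNReal using hc0.le
  have key : c ^ Fintype.card ι ≤ ‖a i + t‖₊ := by
    refine pow_card_le_of_prod_zpow_eq_one (x := fun j => ‖a j + t‖₊) (k := k)
      (by exact_mod_cast hc0.ne') (by exact_mod_cast hc1) ?_ hki hmax ?_
    · simpa using congrArg nnnorm hk
    · intro hlt j hj
      obtain ⟨h1, h2⟩ := hd j i hj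
      have hlt' : ‖a i + t‖ < c := by exact_mod_cast hlt
      have e1 : ‖a j + t‖ ≤ ‖a j - a i‖ + ‖a i + t‖ := by
        rw [← show (a j - a i) + (a i + t) = a j + t by ring]
        exact norm_add_le (a j - a i) (a i + t)
      have e2 : ‖a j - a i‖ ≤ ‖a j + t‖ + ‖a i + t‖ := by
        simpa using norm_sub_le (a j + t) (a i + t)
      rw [← NNReal.coe_le_coe, ← NNReal.coe_le_coe, NNReal.coe_inv, coe_nnnorm]
      constructor <;> linarith
  exact_mod_cast key

/-! ### Bounding the degree -/

/-- The number of real solutions of `∏ i, (b i + x) ^ k i = 1` is bounded independently of the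
exponents: between two consecutive solutions lies one of the points `-b i` or, by Rolle's theorem, a
zero of the logarithmic derivative `∑ i, k i / (b i + x)`. -/
theorem card_le_of_prod_zpow_eq_one {ι : Type*} [Fintype ι] {b : ι → ℝ}
    (hb : Function.Injective b) {k : ι → ℤ} (hk : k ≠ 0) (s : Finset ℝ)
    (hs : ∀ x ∈ s, (∀ i, b i + x ≠ 0) ∧ ∏ i, (b i + x) ^ k i = 1) :
    #s ≤ 2 * Fintype.card ι + 1 := by
  classical
  -- `R` is the numerator of the logarithmic derivative `∑ i, k i / (b i + x)`. It is non-zero because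
  -- it does not vanish at `-b i` when `k i ≠ 0`.
  set R : ℝ[X] := ∑ i, C (k i : ℝ) * ∏ j ∈ univ.erase i, (X + C (b j)) with hR
  have hR0 : R ≠ 0 := by
    obtain ⟨i, hi⟩ := Function.ne_iff.1 hk
    intro h
    have h1 : R.eval (-b i) = 0 := by rw [h, eval_zero]
    rw [hR, eval_finsetSum, Finset.sum_eq_single i] at h1
    · rw [eval_mul, eval_C, eval_prod, mul_eq_zero, Finset.prod_eq_zero_iff] at h1
      rcases h1 with h1 | ⟨j, hj, h1⟩
      · exact hi (by exact_mod_cast h1)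
      · simp only [eval_add, eval_X, eval_C] at h1
        exact Finset.ne_of_mem_erase hj (hb (by linarith))
    · intro j _ hj
      rw [eval_mul, eval_prod, Finset.prod_eq_zero (Finset.mem_erase.2 ⟨hj.symm, Finset.mem_univ i⟩),
        mul_zero]
      simp
    · simp
  have hdeg : R.natDegree ≤ Fintype.card ι := by
    refine natDegree_sum_le_of_forall_le _ _ fun i _ => ?_
    refine (natDegree_C_mul_le _ _).trans ((natDegree_prod_le _ _).trans ?_)
    simp [Finset.card_erase_of_mem]
  have hcard : #(R.roots.toFinset ∪ univ.image fun i => -b i) ≤ 2 * Fintype.card ι := by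
    have h1 := (Multiset.toFinset_card_le R.roots).trans (R.card_roots'.trans hdeg)
    have h2 : #(univ.image fun i => -b i) ≤ Fintype.card ι := Finset.card_image_le
    have h3 := Finset.card_union_le R.roots.toFinset (univ.image fun i => -b i)
    omega
  refine (Finset.card_le_of_interleaved fun x hx y hy hxy _ => ?_).trans
    (Nat.add_le_add_right hcard 1)
  -- Either a point `-b i` separates `x` and `y`, or the logarithm is smooth on `[x, y]`.
  by_cases hpole : ∃ i, x < -b i ∧ -b i < y
  · obtain ⟨i, hi⟩ := hpole
    exact ⟨-b i, by simp, hi⟩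
  push Not at hpole
  have hne : ∀ z ∈ Set.Icc x y, ∀ i, b i + z ≠ 0 := by
    intro z hz i h0
    have hzx : x ≠ z := fun h => (hs x hx).1 i (h ▸ h0)
    have hzy : z ≠ y := fun h => (hs y hy).1 i (h ▸ h0)
    have h1 : -b i = z := by linarith
    have := hpole i (by rw [h1]; exact lt_of_le_of_ne hz.1 hzx)
    rw [h1] at this
    exact absurd (lt_of_le_of_ne hz.2 hzy) this.not_gt
  have hlog : ∀ z, (∀ i, b i + z ≠ 0) ∧ ∏ i, (b i + z) ^ k i = 1 →
      ∑ i, (k i : ℝ) * Real.log (b i + z) = 0 := by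
    rintro z ⟨h0, h1⟩
    have := congrArg Real.log h1
    rw [Real.log_one, Real.log_prod fun i _ => zpow_ne_zero _ (h0 i)] at this
    simpa [Real.log_zpow] using this
  have hderiv : ∀ z ∈ Set.Icc x y, HasDerivAt (fun z => ∑ i, (k i : ℝ) * Real.log (b i + z))
      (∑ i, (k i : ℝ) * (1 / (b i + z))) z := by
    intro z hz
    refine HasDerivAt.fun_sum fun i _ => ?_
    exact (((hasDerivAt_id z).const_add (b i)).log (hne z hz i)).const_mul _
  obtain ⟨z, hz, hz0⟩ := exists_hasDerivAt_eq_zero hxy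
    (fun z hz => (hderiv z hz).continuousAt.continuousWithinAt)
    ((hlog x (hs x hx)).trans (hlog y (hs y hy)).symm)
    (fun z hz => hderiv z (Set.Ioo_subset_Icc_self hz))
  refine ⟨z, Finset.mem_union_left _ ?_, hz⟩
  rw [Multiset.mem_toFinset, mem_roots hR0, IsRoot.def, hR, eval_finsetSum]
  have hzne := hne z (Set.Ioo_subset_Icc_self hz)
  calc ∑ i, eval z (C (k i : ℝ) * ∏ j ∈ univ.erase i, (X + C (b j)))
      = ∑ i, (∏ j, (b j + z)) * ((k i : ℝ) * (1 / (b i + z))) := by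
        refine Finset.sum_congr rfl fun i _ => ?_
        rw [← Finset.mul_prod_erase _ (fun j => b j + z) (Finset.mem_univ i)]
        have := hzne i
        simp only [eval_mul, eval_C, eval_prod, eval_add, eval_X, add_comm z]
        field_simp
    _ = 0 := by rw [← Finset.mul_sum, hz0, mul_zero]

/-- A totally real point satisfying a multiplicative relation has bounded degree. The set `A` holds
the conjugates of the translates `a i`; the hypothesis `hgen` expresses that `t` and the `a i` generate
`L`. -/
theorem card_embeddings_le {n : ℕ} {L : Type*} [Field L] [NumberField L] {a : Fin n → L} {t : L}
    (hgen : ∀ σ τ : L →+* ℂ, (∀ i, σ (a i) = τ (a i)) → σ t = τ t → σ = τ)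
    (hinj : Function.Injective a) (har : ∀ (σ : L →+* ℂ) i, (σ (a i)).im = 0)
    (htr : ∀ σ : L →+* ℂ, (σ t).im = 0) {A : Finset ℂ} (hA : ∀ (σ : L →+* ℂ) i, σ (a i) ∈ A)
    (hu : ∀ j, a j + t ≠ 0) {k : Fin n → ℤ} (hk0 : k ≠ 0) (hk : ∏ j, (a j + t) ^ k j = 1) :
    Fintype.card (L →+* ℂ) ≤ (2 * n + 1) * #A ^ n := by
  classical
  have hcard : #(Fintype.piFinset fun _ : Fin n => A) = #A ^ n := by simp
  rw [← Finset.card_univ, ← hcard]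
  -- Sort the embeddings by their values on the `a i`; within one class an embedding is determined by
  -- the real number `σ t`, which solves the relation with real coefficients.
  refine Finset.card_le_mul_card_image_of_maps_to (f := fun σ i => σ (a i))
    (fun σ _ => Fintype.mem_piFinset.2 (hA σ)) _ fun b _ => ?_
  rcases (univ.filter fun σ : L →+* ℂ => (fun i => σ (a i)) = b).eq_empty_or_nonempty with
    h | ⟨σ₀, hσ₀⟩
  · simp [h]
  simp only [Finset.mem_filter, Finset.mem_univ, true_and] at hσ₀
  have hreal : ∀ σ : L →+* ℂ, (fun i => σ (a i)) = b → ∀ i, (((b i).re + (σ t).re : ℝ) : ℂ)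
      = σ (a i + t) := by
    intro σ hσ i
    apply Complex.ext <;> simp [← hσ, har, htr]
  have hinj_re : Set.InjOn (fun σ : L →+* ℂ => (σ t).re)
      (univ.filter fun σ : L →+* ℂ => (fun i => σ (a i)) = b) := by
    intro σ hσ τ hτ hre
    simp only [Finset.coe_filter, Finset.mem_univ, true_and, Set.mem_ofPred_eq] at hσ hτ
    exact hgen σ τ (fun i => congrFun (hσ.trans hτ.symm) i) (Complex.ext hre (by rw [htr, htr]))
  rw [← Finset.card_image_of_injOn hinj_re]
  have hb : Function.Injective fun i => (b i).re := by
    intro i j hij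
    refine hinj (σ₀.injective ?_)
    exact Complex.ext (by simpa [← hσ₀] using hij) (by rw [har, har])
  refine (card_le_of_prod_zpow_eq_one hb hk0 _ ?_).trans (by simp)
  intro x hx
  simp only [Finset.mem_image, Finset.mem_filter, Finset.mem_univ, true_and] at hx
  obtain ⟨σ, hσ, rfl⟩ := hx
  have hr := hreal σ hσ
  constructor
  · intro i h0
    have := hr i
    rw [h0] at this
    exact hu i ((map_eq_zero σ).1 (by simpa using this.symm))
  · have h1 := congrArg σ hk
    simp only [map_prod, map_zpow₀, map_one, ← hr] at h1
    exact_mod_cast h1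

/-! ### Bounding the conjugates -/

/-- A non-zero algebraic integer all of whose conjugates are at most `B` has no conjugate close to
`0`, since its norm is a non-zero integer. -/
theorem one_le_norm_embedding_mul_pow_of_isIntegral {L : Type*} [Field L] [NumberField L] {β : L}
    (hβ : IsIntegral ℤ β) (hβ0 : β ≠ 0) {B : ℝ} (hB : 1 ≤ B) (h : ∀ σ : L →+* ℂ, ‖σ β‖ ≤ B)
    (σ : L →+* ℂ) : 1 ≤ ‖σ β‖ * B ^ Fintype.card (L →+* ℂ) := by
  classical
  have hnorm : (1 : ℝ) ≤ ∏ τ : L →+* ℂ, ‖τ β‖ := by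
    have hprod : ‖(Algebra.norm ℚ β : ℂ)‖ = ∏ τ : L →+* ℂ, ‖τ β‖ := by
      rw [← eq_ratCast (algebraMap ℚ ℂ), Algebra.norm_eq_prod_embeddings, norm_prod]
      exact Fintype.prod_equiv (RingHom.equivRatAlgHom L ℂ).symm _ _ fun _ => rfl
    obtain ⟨r, hr⟩ := IsIntegrallyClosed.isIntegral_iff.1 (Algebra.isIntegral_norm ℚ hβ)
    have hr0 : r ≠ 0 := by
      rintro rfl
      exact hβ0 ((Algebra.norm_eq_zero_iff (R := ℚ)).1 (by rw [← hr, map_zero]))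
    rw [← hprod, ← hr, eq_intCast, Rat.cast_intCast, Complex.norm_intCast]
    exact_mod_cast Int.one_le_abs hr0
  rw [← Finset.mul_prod_erase _ _ (Finset.mem_univ σ)] at hnorm
  refine hnorm.trans (mul_le_mul_of_nonneg_left ?_ (norm_nonneg _))
  calc ∏ τ ∈ univ.erase σ, ‖τ β‖ ≤ ∏ τ ∈ univ.erase σ, B :=
        Finset.prod_le_prod (fun _ _ => norm_nonneg _) fun τ _ => h τ
    _ = B ^ #(univ.erase σ) := Finset.prod_const _
    _ ≤ _ := pow_le_pow_right₀ hB (Finset.card_le_univ _)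

/-- Some translate `a i + t` has all its conjugates bounded by a constant that depends only on `n`,
the conjugates of the `a i` and their denominators, but neither on `t` nor on the exponents. -/
theorem norm_embedding_le_of_prod_zpow_eq_one {n : ℕ} {L : Type*} [Field L] [NumberField L]
    {a : Fin n → L} {t : L}
    (hgen : ∀ σ τ : L →+* ℂ, (∀ i, σ (a i) = τ (a i)) → σ t = τ t → σ = τ)
    (hinj : Function.Injective a) (har : ∀ (σ : L →+* ℂ) i, (σ (a i)).im = 0)
    (htr : ∀ σ : L →+* ℂ, (σ t).im = 0) {A : Finset ℂ} (hA : ∀ (σ : L →+* ℂ) i, σ (a i) ∈ A)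
    {m : ℤ} (hm0 : m ≠ 0) (ha : ∀ i, IsIntegral ℤ ((m : L) * a i))
    (hd : ∀ i j, IsIntegral ℤ ((m : L) * (a i - a j)⁻¹)) {c : ℝ} (hc0 : 0 < c) (hc1 : c ≤ 1)
    (hcA : ∀ x ∈ A, ∀ y ∈ A, x ≠ y → 2 * c ≤ ‖x - y‖ ∧ ‖x - y‖ + c ≤ c⁻¹)
    (ht : IsIntegral ℤ t) (hu : ∀ j, a j + t ≠ 0) {k : Fin n → ℤ} (hk0 : k ≠ 0)
    (hk : ∏ j, (a j + t) ^ k j = 1) :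
    ∃ i, ∀ σ : L →+* ℂ, ‖σ (a i + t)‖ ≤
      |(m : ℝ)| ^ n * ((|(m : ℝ)| / c) ^ n) ^ ((2 * n + 1) * #A ^ n) := by
  obtain ⟨i₀, hi₀⟩ := Function.ne_iff.1 hk0
  obtain ⟨i, -, hmax⟩ := Finset.exists_max_image univ (fun j => (k j).natAbs) ⟨i₀, mem_univ _⟩
  replace hmax := fun j => hmax j (mem_univ j)
  have hki : k i ≠ 0 := by
    have := hmax i₀
    have : k i₀ ≠ 0 := hi₀
    omega
  refine ⟨i, fun σ => ?_⟩
  have hmL : (m : L) ≠ 0 := Int.cast_ne_zero.2 hm0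
  have hm1 : (1 : ℝ) ≤ |(m : ℝ)| := by exact_mod_cast Int.one_le_abs hm0
  have hβ : IsIntegral ℤ ((m : L) ^ n * (a i + t)⁻¹) := by
    have := isIntegral_pow_card_div_of_prod_zpow_eq_one hmL
      (by simpa using isIntegral_algebraMap (R := ℤ) (A := L) (x := m)) ha
      (fun i j hij => ⟨hinj.ne hij, hd i j⟩) ht hu hk hki hmax
    rwa [Fintype.card_fin] at this
  have hnorm : ∀ τ : L →+* ℂ,
      ‖τ ((m : L) ^ n * (a i + t)⁻¹)‖ = |(m : ℝ)| ^ n / ‖τ (a i + t)‖ := by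
    intro τ
    simp [div_eq_mul_inv]
  have hpos : 0 < ‖σ (a i + t)‖ := norm_pos_iff.2 ((map_ne_zero σ).2 (hu i))
  have hB : (1 : ℝ) ≤ (|(m : ℝ)| / c) ^ n :=
    one_le_pow₀ ((one_le_div hc0).2 (hc1.trans hm1))
  have hle := one_le_norm_embedding_mul_pow_of_isIntegral hβ
    (mul_ne_zero (pow_ne_zero _ hmL) (inv_ne_zero (hu i))) hB (fun τ => ?_) σ
  · rw [hnorm, div_mul_eq_mul_div, one_le_div hpos] at hle
    refine hle.trans (mul_le_mul_of_nonneg_left (pow_le_pow_right₀ hB ?_) (by positivity))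
    exact card_embeddings_le hgen hinj har htr hA hu hk0 hk
  · have := pow_card_le_norm_of_prod_zpow_eq_one (a := fun j => τ (a j)) (t := τ t) hc0 hc1
      (fun i j hij => hcA _ (hA τ i) _ (hA τ j) ((τ.injective.comp hinj).ne hij))
      (k := k) (by simpa using congrArg τ hk) hki hmax
    rw [Fintype.card_fin, ← map_add] at this
    rw [hnorm, div_pow]
    gcongr

/-! ### Constants depending only on the translates, and the conclusion -/

theorem exists_int_mul_isIntegral {κ K : Type*} [Finite κ] [Field K] [CharZero K] {f : κ → K}
    (hf : ∀ x, IsAlgebraic ℚ (f x)) : ∃ m : ℤ, m ≠ 0 ∧ ∀ x, IsIntegral ℤ ((m : K) * f x) := by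
  classical
  have := Fintype.ofFinite κ
  have h : ∀ x, ∃ y : ℤ, y ≠ 0 ∧ IsIntegral ℤ ((y : K) * f x) := fun x => by
    obtain ⟨y, hy, hi⟩ :=
      ((IsFractionRing.isAlgebraic_iff ℤ ℚ K).2 (hf x)).exists_integral_multiple
    exact ⟨y, hy, by simpa [zsmul_eq_mul] using hi⟩
  choose y hy hi using h
  refine ⟨∏ x, y x, Finset.prod_ne_zero_iff.2 fun x _ => hy x, fun x => ?_⟩
  rw [← Finset.mul_prod_erase _ _ (Finset.mem_univ x), Int.cast_mul, mul_right_comm]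
  exact (hi x).mul (isIntegral_algebraMap (R := ℤ) (A := K))

/-- The constant `c` of the archimedean lower bound, chosen for all conjugates at once. -/
theorem exists_pos_separation (A : Finset ℂ) : ∃ c : ℝ, 0 < c ∧ c ≤ 1 ∧
    ∀ x ∈ A, ∀ y ∈ A, x ≠ y → 2 * c ≤ ‖x - y‖ ∧ ‖x - y‖ + c ≤ c⁻¹ := by
  open Filter Topology in
  have hlim : Tendsto (fun c : ℝ => c⁻¹ - c) (𝓝[>] 0) atTop :=
    tendsto_inv_nhdsGT_zero.atTop_add
      ((continuous_neg.tendsto (0 : ℝ)).mono_left nhdsWithin_le_nhds)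
  have hev : ∀ᶠ c : ℝ in 𝓝[>] 0, 0 < c ∧ c ≤ 1 ∧
      ∀ x ∈ A, ∀ y ∈ A, x ≠ y → 2 * c ≤ ‖x - y‖ ∧ ‖x - y‖ + c ≤ c⁻¹ := by
    refine (eventually_mem_nhdsWithin).and (Eventually.and ?_ ?_)
    · exact (eventually_le_nhds one_pos).filter_mono nhdsWithin_le_nhds
    · refine (Filter.eventually_all_finset A).2 fun x _ =>
        (Filter.eventually_all_finset A).2 fun y _ => ?_
      by_cases hxy : x = y
      · simp [hxy]
      have hpos : 0 < ‖x - y‖ / 2 := half_pos (norm_pos_iff.2 (sub_ne_zero.2 hxy))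
      filter_upwards [(eventually_le_nhds hpos).filter_mono nhdsWithin_le_nhds,
        hlim.eventually_ge_atTop ‖x - y‖] with c h1 h2 _
      exact ⟨by linarith, by linarith⟩
  exact hev.exists

theorem mainTheorem2 (n : ℕ) (hn : 2 ≤ n) (α : Fin n → ℂ)
    (hα : ∀ i, IsTotallyRealNumber (α i)) (hinj : Function.Injective α) :
    ∃ C : ℝ, 0 < C ∧ ∀ t : ℂ, IsIntegral ℤ t → IsTotallyRealNumber t → C ≤ algHouse t →
      MultiplicativelyIndependent (fun i => α i + t) := by
  classical
  set A : Finset ℂ := univ.biUnion fun i => ((minpoly ℚ (α i)).rootSet ℂ).toFinset with hAdef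
  obtain ⟨c, hc0, hc1, hcA⟩ := exists_pos_separation A
  obtain ⟨m₁, hm₁, hi₁⟩ := exists_int_mul_isIntegral fun i => (hα i).1
  -- Diagonal pairs do no harm here: they contribute `0⁻¹ = 0`, which is integral.
  obtain ⟨m₂, hm₂, hi₂⟩ := exists_int_mul_isIntegral
    fun p : Fin n × Fin n => ((hα p.1).1.sub (hα p.2).1).inv
  obtain ⟨m, hm0, ha, hd⟩ : ∃ m : ℤ, m ≠ 0 ∧ (∀ i, IsIntegral ℤ ((m : ℂ) * α i)) ∧
      ∀ i j, IsIntegral ℤ ((m : ℂ) * (α i - α j)⁻¹) := by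
    have hint : ∀ z : ℤ, IsIntegral ℤ (z : ℂ) := fun z => by
      simpa using isIntegral_algebraMap (R := ℤ) (A := ℂ) (x := z)
    refine ⟨m₁ * m₂, mul_ne_zero hm₁ hm₂, fun i => ?_, fun i j => ?_⟩
    · rw [Int.cast_mul, mul_right_comm]
      exact (hi₁ i).mul (hint _)
    · rw [Int.cast_mul, mul_assoc]
      exact (hint _).mul (hi₂ (i, j))
  set E : ℝ := |(m : ℝ)| ^ n * ((|(m : ℝ)| / c) ^ n) ^ ((2 * n + 1) * #A ^ n)
  have hE0 : 0 ≤ E := by positivity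
  set R : ℝ := ∑ z ∈ A, ‖z‖
  have hR0 : 0 ≤ R := Finset.sum_nonneg fun z _ => norm_nonneg z
  have hAR : ∀ z ∈ A, ‖z‖ ≤ R := fun z hz =>
    Finset.single_le_sum (f := fun z : ℂ => ‖z‖) (fun z _ => norm_nonneg z) hz
  refine ⟨E + R + 1, by positivity, fun t ht htr hC => ?_⟩
  let S : Set ℂ := insert t (Set.range α)
  let L : IntermediateField ℚ ℂ := IntermediateField.adjoin ℚ S
  have : Finite S := ((Set.finite_range α).insert t).to_subtype
  have : FiniteDimensional ℚ L := IntermediateField.finiteDimensional_adjoin fun x hx => by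
    rcases hx with rfl | ⟨i, rfl⟩
    · exact htr.1.isIntegral
    · exact (hα i).1.isIntegral
  have : NumberField L := ⟨⟩
  let t' : L := ⟨t, IntermediateField.subset_adjoin ℚ S (Set.mem_insert _ _)⟩
  let a : Fin n → L := fun i =>
    ⟨α i, IntermediateField.subset_adjoin ℚ S (Set.mem_insert_of_mem _ ⟨i, rfl⟩)⟩
  have hroot : ∀ x : L, (Set.range fun σ : L →+* ℂ => σ x) = algConjugates x := fun x => by
    rw [NumberField.Embeddings.range_eval_eq_rootSet_minpoly]
    exact congrArg (fun p : ℚ[X] => p.rootSet ℂ)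
      (minpoly.algebraMap_eq (algebraMap L ℂ).injective x).symm
  have hconj : ∀ (σ : L →+* ℂ) (x : L), σ x ∈ algConjugates x := fun σ x =>
    hroot x ▸ Set.mem_range_self σ
  have hA : ∀ (σ : L →+* ℂ) i, σ (a i) ∈ A := fun σ i => by
    rw [hAdef, Finset.mem_biUnion]
    exact ⟨i, Finset.mem_univ i, Set.mem_toFinset.2 (hconj σ (a i))⟩
  have hgen : ∀ σ τ : L →+* ℂ, (∀ i, σ (a i) = τ (a i)) → σ t' = τ t' → σ = τ := by
    intro σ τ h1 h2
    ext ⟨x, hx⟩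
    induction hx using IntermediateField.adjoin_induction with
    | mem x hx =>
      rcases hx with rfl | ⟨i, rfl⟩
      exacts [h2, h1 i]
    | algebraMap q =>
      exact RingHom.congr_fun (Subsingleton.elim (σ.comp (algebraMap ℚ L))
        (τ.comp (algebraMap ℚ L))) q
    | add x y hx hy ihx ihy =>
      exact (map_add σ ⟨x, hx⟩ ⟨y, hy⟩).trans ((congrArg₂ _ ihx ihy).trans (map_add τ _ _).symm)
    | inv x hx ih => exact (map_inv₀ σ ⟨x, hx⟩).trans ((congrArg _ ih).trans (map_inv₀ τ _).symm)
    | mul x y hx hy ihx ihy =>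
      exact (map_mul σ ⟨x, hx⟩ ⟨y, hy⟩).trans ((congrArg₂ _ ihx ihy).trans (map_mul τ _ _).symm)
  -- If all conjugates of some `α i + t` were at most `E`, the house of `t` would be at most `E + R`.
  have hbig : ∀ i, ¬ ∀ σ : L →+* ℂ, ‖σ (a i + t')‖ ≤ E := by
    intro i h
    have hle : algHouse t ≤ E + R := by
      refine Real.sSup_le ?_ (by positivity)
      rintro _ ⟨z, hz, rfl⟩
      obtain ⟨σ, rfl⟩ := (hroot t').symm ▸ hz
      have h1 := hAR _ (hA σ i)
      have h2 := h σ
      have h3 := norm_sub_le (σ (a i + t')) (σ (a i))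
      rw [← map_sub, add_sub_cancel_left] at h3
      exact h3.trans (add_le_add h2 h1)
    linarith
  -- A vanishing translate has all its conjugates equal to `0 ≤ E`.
  have hu : ∀ i, a i + t' ≠ 0 := fun i h => hbig i fun σ => by simpa [h] using hE0
  refine ⟨fun i h => hu i (Subtype.ext h), fun k hk => ?_⟩
  by_contra hk0
  have hkL : ∏ j, (a j + t') ^ k j = 1 := by
    apply (algebraMap L ℂ).injective
    simpa [map_prod, map_zpow₀] using hk
  have hintL : ∀ {x : L}, IsIntegral ℤ (x : ℂ) → IsIntegral ℤ x := fun hx =>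
    (isIntegral_algebraMap_iff (algebraMap L ℂ).injective).1 hx
  obtain ⟨i, hi⟩ := norm_embedding_le_of_prod_zpow_eq_one hgen
    (fun i j hij => hinj (congrArg Subtype.val hij))
    (fun σ i => (hα i).2 _ (hconj σ (a i))) (fun σ => htr.2 _ (hconj σ t')) hA hm0
    (fun i => hintL (by simpa using ha i)) (fun i j => hintL (by simpa using hd i j))
    hc0 hc1 hcA (hintL ht) hu hk0 hkL
  exact hbig i hi
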